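/- Notation. $\mathbb D=\{z\in\mathbb C:|z|<1\}$; for a polynomial $P$ of degree at most $n$, its reversal in degree $n$ is $z^n\overline{P(1/\bar z)}$. A Schur function is an analytic function $g$ on $\mathbb D$ with $|g|\le 1$ there. Zeros of functions and of polynomials, and poles, are counted with multiplicity. Equalities between meromorphic functions on $\mathbb D$ hold off a set without accumulation points in $\mathbb D$. Let $N\ge 0$ be an integer and let $(\alpha_n)_{n\ge 0}$ be a sequence of complex numbers with $|\alpha_n|\neq 1$ for $0\le n<N$ and $|\alpha_n|<1$ for $n\ge N$. Let $\Phi_0=1$, $\Phi_{n+1}(z)=z\Phi_n(z)-\overline{\alpha_n}\,\Phi_n^*(z)$, where $\Phi_n^*$ is the reversal of $\Phi_n$ in degree $n$. Let $\Psi_n$ and $\Psi_n^*$ be the polynomials obtained in the same way from the sequence $(-\alpha_n)_{n\ge0}$ (the polynomials of the second kind). Let $A_n,B_n$ ($n\ge -1$) be the Wall polynomials: $A_{-1}=0$, $B_{-1}=1$, $A_n=A_{n-1}+\alpha_n zB_{n-1}^*$, $B_n=B_{n-1}+\alpha_n zA_{n-1}^*$, where $zA_{n-1}^*$ and $zB_{n-1}^*$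 are the reversals in degree $n$ of $A_{n-1}$ and $B_{n-1}$. Let $f_N$ be the Schur function corresponding to the coefficients $\alpha_N,\alpha_{N+1},\dots$, that is, the first member of a sequence of Schur functions $f_N,f_{N+1},\dots$ with $$f_n(z)=\frac{\alpha_n+zf_{n+1}(z)}{1+\overline{\alpha_n}\,zf_{n+1}(z)},\qquad z\in\mathbb D,\ n\ge N.\qquad(1)$$ Put $$f=\frac{A_{N-1}+zB_{N-1}^*f_N}{B_{N-1}+zA_{N-1}^*f_N},\qquad F=\frac{1+zf}{1-zf},\qquad R(z)=\Phi_N^*(z)-z\Phi_N(z)f_N(z).$$ Then such a Schur function $f_N$ exists, and for it the following hold. (a) $f_N$ is the $N$-th iterate of the generalized Schur algorithm of $f$: there are functions $f_0=f,f_1,f_2,\dots$, meromorphic in $\mathbb D$ and regular at $0$, whose $N$-th member is $f_N$, which satisfy (1) as meromorphic functions for all $n\ge 0$, and which are Schur functions for $n\ge N$. (b) As meromorphic functions in $\mathbb D$, $$F(z)=\frac{\Psi_N^*(z)+z\Psi_N(z)f_N(z)}{\Phi_N^*(z)-z\Phi_N(z)f_N(z)}.$$ (c) $F$ is meromorphic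 in $\mathbb D$, and its poles in $\mathbb D$ are exactly the zeros of $R$ in $\mathbb D$, with the same multiplicities. (d) The number of poles of $F$ in $\mathbb D$ is finite and does not exceed the number of zeros of $\Phi_N^*$ in $\mathbb D$. -/

import Mathlib

open Polynomial

namespace NonclassicalOPUC

/-- The open unit disk `𝔻`. -/
abbrev unitDisk : Set ℂ := Metric.ball 0 1

/-- The reversed polynomial `p^*(z) = z ^ n * conj (p (1 / conj z))`
of a polynomial `p` of degree at most `n`. -/
noncomputable def reversed (n : ℕ) (p : ℂ[X]) : ℂ[X] :=
  (p.map (starRingEnd ℂ)).reflect n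

/-- The monic polynomials `Φ_n` of the Szegő recurrence with coefficients `α`:
`Φ_0 = 1` and `Φ_{n+1} = z Φ_n - conj (α_n) Φ_n^*`. -/
noncomputable def szegoPoly (α : ℕ → ℂ) : ℕ → ℂ[X]
  | 0 => 1
  | n + 1 => X * szegoPoly α n - C (starRingEnd ℂ (α n)) * reversed n (szegoPoly α n)

/-- `Φ_n^*`. -/
noncomputable def szegoPolyStar (α : ℕ → ℂ) (n : ℕ) : ℂ[X] :=
  reversed n (szegoPoly α n)

/-- The polynomials `Ψ_n` of the second kind: the coefficients `α_n` are replaced by `-α_n`. -/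
noncomputable def secondKindPoly (α : ℕ → ℂ) (n : ℕ) : ℂ[X] :=
  szegoPoly (fun k => -α k) n

/-- `Ψ_n^*`. -/
noncomputable def secondKindPolyStar (α : ℕ → ℂ) (n : ℕ) : ℂ[X] :=
  reversed n (secondKindPoly α n)

/-- The Wall polynomials: `wallPair α n = (A_{n-1}, B_{n-1})`, where
`A_{-1} = 0`, `B_{-1} = 1`, `A_n = A_{n-1} + α_n z B_{n-1}^*`, `B_n = B_{n-1} + α_n z A_{n-1}^*`.
Since `A_{n-1}^*` and `B_{n-1}^*` are reversals in degree `n - 1`, the products `z A_{n-1}^*` and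
`z B_{n-1}^*` are the reversals of `A_{n-1}` and `B_{n-1}` in degree `n`. -/
noncomputable def wallPair (α : ℕ → ℂ) : ℕ → ℂ[X] × ℂ[X]
  | 0 => (0, 1)
  | n + 1 =>
      ((wallPair α n).1 + C (α n) * reversed n (wallPair α n).2,
        (wallPair α n).2 + C (α n) * reversed n (wallPair α n).1)

/-- `wallA α N` is the Wall polynomial `A_{N-1}`. -/
noncomputable def wallA (α : ℕ → ℂ) (N : ℕ) : ℂ[X] := (wallPair α N).1

/-- `wallB α N` is the Wall polynomial `B_{N-1}`. -/
noncomputable def wallB (α : ℕ → ℂ) (N : ℕ) : ℂ[X] := (wallPair α N).2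

/-- A Schur function: analytic in the unit disk and bounded there by one. -/
def IsSchurFunction (f : ℂ → ℂ) : Prop :=
  AnalyticOnNhd ℂ f unitDisk ∧ ∀ z ∈ unitDisk, ‖f z‖ ≤ 1

/-- One step of the (generalized) Schur algorithm,
`z ↦ (a + z g(z)) / (1 + conj a * z g(z))`. -/
noncomputable def schurStep (a : ℂ) (g : ℂ → ℂ) (z : ℂ) : ℂ :=
  (a + z * g z) / (1 + starRingEnd ℂ a * z * g z)

/-- `f` is the classical Schur function corresponding to the coefficients `α_0, α_1, …` (of
modulus less than one): it is the first member of a sequence of Schur functions related by the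
Schur algorithm. The denominators do not vanish in the disk when `|α_n| < 1`. -/
def IsSchurFunctionOf (α : ℕ → ℂ) (f : ℂ → ℂ) : Prop :=
  ∃ s : ℕ → ℂ → ℂ, s 0 = f ∧ (∀ n, IsSchurFunction (s n)) ∧
    ∀ n, ∀ z ∈ unitDisk, s n z = schurStep (α n) (s (n + 1)) z

/-- `s` is a sequence of functions generated by the generalized Schur algorithm with coefficients
`α`: the `s n` are meromorphic in the disk, regular at the origin, and
`s n = (α_n + z s (n + 1)) / (1 + conj α_n z s (n + 1))` as meromorphic functions, that is,
outside a set without accumulation points in the disk. -/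
def IsGeneralizedSchurSequence (α : ℕ → ℂ) (s : ℕ → ℂ → ℂ) : Prop :=
  ∀ n, MeromorphicOn (s n) unitDisk ∧ AnalyticAt ℂ (s n) 0 ∧
    s n =ᶠ[Filter.codiscreteWithin unitDisk] schurStep (α n) (s (n + 1))

/-- The function `f = (A_{N-1} + z B_{N-1}^* f_N) / (B_{N-1} + z A_{N-1}^* f_N)`. -/
noncomputable def wallTransform (α : ℕ → ℂ) (N : ℕ) (fN : ℂ → ℂ) (z : ℂ) : ℂ :=
  ((wallA α N).eval z + (reversed N (wallB α N)).eval z * fN z) /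
    ((wallB α N).eval z + (reversed N (wallA α N)).eval z * fN z)

/-- The function `F = (1 + z f) / (1 - z f)`. -/
noncomputable def caratheodoryTransform (f : ℂ → ℂ) (z : ℂ) : ℂ :=
  (1 + z * f z) / (1 - z * f z)

/-- The order of the pole of `F` at `z`; it is zero where `F` has no pole. -/
noncomputable def poleOrder (F : ℂ → ℂ) (z : ℂ) : ℕ :=
  (-(meromorphicOrderAt F z).untop₀).toNat

/-- The poles of `F` in the unit disk. -/
def polesInDisk (F : ℂ → ℂ) : Set ℂ :=
  {z | z ∈ unitDisk ∧ meromorphicOrderAt F z < 0}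

/-- The number of poles of `F` in the unit disk, counted with multiplicity
(for `F` with finitely many poles there). -/
noncomputable def numPolesInDisk (F : ℂ → ℂ) : ℕ :=
  ∑ᶠ z ∈ polesInDisk F, poleOrder F z

open Classical in
/-- The number of zeros of a nonzero polynomial in the unit disk, counted with multiplicity. -/
noncomputable def numZerosInDisk (p : ℂ[X]) : ℕ :=
  (p.roots.filter (fun z => z ∈ unitDisk)).card

end NonclassicalOPUC

open NonclassicalOPUC

open NonclassicalOPUC

/-! One Schur step is a linear fractional map, and the Wall polynomials are the entries of the
product of the corresponding matrices. Splitting off the leftmost factor (`wall_succ_left`) exhibits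
each iterate below `N` as a Wall transform of `f_N` with shifted coefficients, which gives (a). The
Pinter–Nevai formulas express `Φ_N`, `Ψ_N` and their reversals through Wall polynomials, so `(1 +
zf)/(1 - zf)` becomes the quotient in (b). By `secondKind_wronskian`, a common zero of its numerator
and denominator could lie only at 0, where `R = 1`; hence nothing cancels and (c) follows. The
function `f_N` itself is the limit of finite Schur approximants, whose convergence comes from the
Schwarz lemma.

The hard part is (d). On the circle `‖zΦ_N‖ = ‖Φ_N^*‖` and `‖f_N‖ ≤ 1` inside, so `R` looks like a
perturbation of `Φ_N^*` as in Rouché's theorem; but the inequality is not strict, and `f_N` need not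
extend continuously to the circle. `card_le_card_of_sub_mul_eq_rootPoly_mul` replaces Rouché by a
maximum principle. If `R = P S` had more extracted zeros than `p = Φ_N^*`, then `R/p`, multiplied by
the positive weight `‖A‖²/‖P‖²` (with `A` the factor of `p` carrying its zeros in the disk), would
agree on a circle near the unit circle with a holomorphic `H` vanishing at 0. Since `‖R‖²` is at
most a constant times `Re H` plus a small error, the value `R(0) = 1` is contradicted. -/

namespace NonclassicalOPUC

open scoped ComplexConjugate Topology
open Filter

/-! ### Algebra of reversed polynomials. -/

section Reversal

theorem reversed_add (n : ℕ) (p q : ℂ[X]) :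
    reversed n (p + q) = reversed n p + reversed n q := by
  simp [reversed, reflect_add]

theorem reversed_sub (n : ℕ) (p q : ℂ[X]) :
    reversed n (p - q) = reversed n p - reversed n q := by
  simp [reversed, reflect_sub]

theorem reversed_neg (n : ℕ) (p : ℂ[X]) : reversed n (-p) = -reversed n p := by
  simp [reversed, reflect_neg]

theorem reversed_C_mul (n : ℕ) (c : ℂ) (p : ℂ[X]) :
    reversed n (C c * p) = C (conj c) * reversed n p := by
  simp [reversed, reflect_C_mul]

theorem reversed_reversed (n : ℕ) (p : ℂ[X]) : reversed n (reversed n p) = p := by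
  ext i
  simp [reversed, coeff_reflect]

theorem natDegree_reversed_le {n : ℕ} {p : ℂ[X]} (hp : p.natDegree ≤ n) :
    (reversed n p).natDegree ≤ n := by
  refine natDegree_reflect_le.trans (max_le le_rfl ?_)
  exact natDegree_map_le.trans hp

theorem reversed_succ {n : ℕ} {p : ℂ[X]} (hp : p.natDegree ≤ n) :
    reversed (n + 1) p = X * reversed n p := by
  have h := reflect_mul (p.map (starRingEnd ℂ)) (1 : ℂ[X]) (F := n) (G := 1)
    (natDegree_map_le.trans hp) (by simp)
  rw [mul_one, reflect_one, pow_one, mul_comm] at h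
  exact h

theorem reversed_succ_X_mul {n : ℕ} {p : ℂ[X]} (hp : p.natDegree ≤ n) :
    reversed (n + 1) (X * p) = reversed n p := by
  have h := reflect_mul (p.map (starRingEnd ℂ)) (X : ℂ[X]) (F := n) (G := 1)
    (natDegree_map_le.trans hp) (by simp)
  rw [reflect_one_X, mul_one, mul_comm] at h
  simpa [reversed] using h

theorem reversed_one (n : ℕ) : reversed n 1 = X ^ n := by
  simp [reversed, reflect_one]

theorem reversed_zero (n : ℕ) : reversed n 0 = 0 := by
  simp [reversed]

end Reversal

/-! ### Szegő polynomials: recurrences, boundary moduli, Wronskian. -/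

section Szego

variable (α : ℕ → ℂ)

theorem natDegree_szegoPoly_le (n : ℕ) : (szegoPoly α n).natDegree ≤ n := by
  induction n with
  | zero => simp [szegoPoly]
  | succ n ih =>
    rw [szegoPoly]
    refine (natDegree_sub_le _ _).trans (max_le ?_ ?_)
    · refine natDegree_mul_le.trans ?_
      rw [natDegree_X]
      omega
    · exact (natDegree_C_mul_le _ _).trans ((natDegree_reversed_le ih).trans n.le_succ)

theorem szegoPoly_succ (n : ℕ) :
    szegoPoly α (n + 1) = X * szegoPoly α n - C (conj (α n)) * szegoPolyStar α n := rfl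

theorem szegoPolyStar_zero : szegoPolyStar α 0 = 1 := by
  simp [szegoPolyStar, szegoPoly, reversed_one]

theorem szegoPolyStar_succ (n : ℕ) :
    szegoPolyStar α (n + 1) = szegoPolyStar α n - C (α n) * (X * szegoPoly α n) := by
  have hd := natDegree_szegoPoly_le α n
  rw [szegoPolyStar, szegoPoly_succ, reversed_sub, reversed_succ_X_mul hd, reversed_C_mul,
    szegoPolyStar, reversed_succ (natDegree_reversed_le hd), reversed_reversed,
    Complex.conj_conj]

theorem eval_zero_szegoPolyStar (n : ℕ) : (szegoPolyStar α n).eval 0 = 1 := by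
  induction n with
  | zero => simp [szegoPolyStar_zero]
  | succ n ih => simp [szegoPolyStar_succ, ih]

theorem szegoPolyStar_ne_zero (n : ℕ) : szegoPolyStar α n ≠ 0 := by
  intro h
  simpa [h] using eval_zero_szegoPolyStar α n

/-- On the unit circle, `Φ_n^* = z ^ n * conj Φ_n`. -/
theorem eval_szegoPolyStar_of_norm_eq_one {z : ℂ} (hz : ‖z‖ = 1) (n : ℕ) :
    (szegoPolyStar α n).eval z = z ^ n * conj ((szegoPoly α n).eval z) := by
  have hzz : z * conj z = 1 := by
    rw [Complex.mul_conj, Complex.normSq_eq_norm_sq, hz]; simp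
  induction n with
  | zero => simp [szegoPolyStar_zero, szegoPoly]
  | succ n ih =>
    rw [szegoPolyStar_succ, szegoPoly_succ]
    simp only [eval_sub, eval_mul, eval_C, eval_X, map_sub, map_mul, Complex.conj_conj]
    rw [ih]
    have hp : z ^ n * conj z ^ n = 1 := by rw [← mul_pow, hzz, one_pow]
    simp only [map_mul, map_pow, Complex.conj_conj]
    linear_combination (-(z ^ n * conj ((szegoPoly α n).eval z))) * hzz
      + α n * z * (szegoPoly α n).eval z * hp

theorem norm_eval_szegoPolyStar_of_norm_eq_one {z : ℂ} (hz : ‖z‖ = 1) (n : ℕ) :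
    ‖(szegoPolyStar α n).eval z‖ = ‖(szegoPoly α n).eval z‖ := by
  rw [eval_szegoPolyStar_of_norm_eq_one α hz, norm_mul, norm_pow, hz, Complex.norm_conj]
  simp

theorem secondKindPoly_succ (n : ℕ) :
    secondKindPoly α (n + 1) =
      X * secondKindPoly α n + C (conj (α n)) * secondKindPolyStar α n := by
  rw [secondKindPoly, szegoPoly_succ, map_neg, C_neg, neg_mul, sub_neg_eq_add]
  rfl

theorem secondKindPolyStar_succ (n : ℕ) :
    secondKindPolyStar α (n + 1) =
      secondKindPolyStar α n + C (α n) * (X * secondKindPoly α n) := by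
  have h := szegoPolyStar_succ (fun k => -α k) n
  rw [C_neg, neg_mul, sub_neg_eq_add] at h
  exact h

/-- The Wronskian-type identity for the polynomials of the first and second kind. -/
theorem secondKind_wronskian (n : ℕ) :
    secondKindPolyStar α n * szegoPoly α n + secondKindPoly α n * szegoPolyStar α n =
      C (2 * ∏ k ∈ Finset.range n, (1 - α k * conj (α k))) * X ^ n := by
  induction n with
  | zero =>
    have h1 : secondKindPolyStar α 0 = 1 := szegoPolyStar_zero _
    have h2 : secondKindPoly α 0 = 1 := rfl
    have h3 : szegoPoly α 0 = 1 := rfl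
    rw [h1, h2, h3, szegoPolyStar_zero]
    simp only [Finset.range_zero, Finset.prod_empty, mul_one, pow_zero]
    exact one_add_one_eq_two.trans (map_ofNat C 2).symm
  | succ n ih =>
    rw [Finset.prod_range_succ, secondKindPoly_succ, secondKindPolyStar_succ, szegoPoly_succ,
      szegoPolyStar_succ]
    simp only [C_mul, C_sub, C_1] at ih ⊢
    -- One recurrence step multiplies the Wronskian by `z (1 - |α_n|²)`, the determinant of its
    -- transfer matrix.
    linear_combination X * (1 - C (α n) * C (conj (α n))) * ih

theorem prod_one_sub_mul_conj_ne_zero {n : ℕ} (hne : ∀ k < n, ‖α k‖ ≠ 1) :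
    ∏ k ∈ Finset.range n, (1 - α k * conj (α k)) ≠ 0 := by
  refine Finset.prod_ne_zero_iff.2 fun k hk h0 => hne k (Finset.mem_range.1 hk) ?_
  rw [Complex.mul_conj, Complex.normSq_eq_norm_sq, sub_eq_zero] at h0
  have h1 : ‖α k‖ ^ 2 = 1 := by exact_mod_cast h0.symm
  exact (pow_eq_one_iff_of_nonneg (norm_nonneg _) two_ne_zero).1 h1

/-- At a zero on the circle `Φ_n` would vanish too, having the same modulus there, and the Wronskian
would be zero. -/
theorem eval_szegoPolyStar_ne_zero_of_norm_eq_one {n : ℕ} (hne : ∀ k < n, ‖α k‖ ≠ 1) {z : ℂ}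
    (hz : ‖z‖ = 1) : (szegoPolyStar α n).eval z ≠ 0 := by
  intro h
  have h' : (szegoPoly α n).eval z = 0 := by
    rw [← norm_eq_zero, ← norm_eval_szegoPolyStar_of_norm_eq_one α hz, h, norm_zero]
  have hw := congrArg (eval z) (secondKind_wronskian α n)
  simp only [eval_add, eval_mul, h, h', mul_zero, add_zero, eval_C, eval_pow, eval_X] at hw
  have hz0 : z ≠ 0 := by rintro rfl; simp at hz
  have hp := prod_one_sub_mul_conj_ne_zero α hne
  exact mul_ne_zero (mul_ne_zero two_ne_zero hp) (pow_ne_zero n hz0) hw.symm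

end Szego

/-! ### Wall polynomials as entries of transfer matrices. -/

section Wall

variable (α : ℕ → ℂ)

/-- `wallAStar α N` is `z A_{N-1}^*`, the reversal of `A_{N-1}` in degree `N`. -/
noncomputable def wallAStar (n : ℕ) : ℂ[X] := reversed n (wallA α n)

/-- `wallBStar α N` is `z B_{N-1}^*`, the reversal of `B_{N-1}` in degree `N`. -/
noncomputable def wallBStar (n : ℕ) : ℂ[X] := reversed n (wallB α n)

theorem wallA_zero : wallA α 0 = 0 := rfl

theorem wallB_zero : wallB α 0 = 1 := rfl

theorem wallAStar_zero : wallAStar α 0 = 0 := by simp [wallAStar, wallA_zero, reversed_zero]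

theorem wallBStar_zero : wallBStar α 0 = 1 := by simp [wallBStar, wallB_zero, reversed_one]

theorem wallA_succ (n : ℕ) : wallA α (n + 1) = wallA α n + C (α n) * wallBStar α n := rfl

theorem wallB_succ (n : ℕ) : wallB α (n + 1) = wallB α n + C (α n) * wallAStar α n := rfl

theorem natDegree_wall_le (n : ℕ) :
    (wallA α n).natDegree ≤ n ∧ (wallB α n).natDegree ≤ n := by
  induction n with
  | zero => simp [wallA_zero, wallB_zero]
  | succ n ih =>
    rw [wallA_succ, wallB_succ]
    exact ⟨natDegree_add_le_of_degree_le (ih.1.trans n.le_succ)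
        ((natDegree_C_mul_le _ _).trans ((natDegree_reversed_le ih.2).trans n.le_succ)),
      natDegree_add_le_of_degree_le (ih.2.trans n.le_succ)
        ((natDegree_C_mul_le _ _).trans ((natDegree_reversed_le ih.1).trans n.le_succ))⟩

theorem wallAStar_succ (n : ℕ) :
    wallAStar α (n + 1) = X * (wallAStar α n + C (conj (α n)) * wallB α n) := by
  obtain ⟨hA, hB⟩ := natDegree_wall_le α n
  rw [wallAStar, wallA_succ, reversed_add, reversed_succ hA, reversed_C_mul, wallBStar,
    reversed_succ (natDegree_reversed_le hB), reversed_reversed, wallAStar]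
  ring

theorem wallBStar_succ (n : ℕ) :
    wallBStar α (n + 1) = X * (wallBStar α n + C (conj (α n)) * wallA α n) := by
  obtain ⟨hA, hB⟩ := natDegree_wall_le α n
  rw [wallBStar, wallB_succ, reversed_add, reversed_succ hB, reversed_C_mul, wallAStar,
    reversed_succ (natDegree_reversed_le hA), reversed_reversed, wallBStar]
  ring

theorem eval_zero_wallAStar (n : ℕ) : (wallAStar α n).eval 0 = 0 := by
  cases n with
  | zero => simp [wallAStar_zero]
  | succ n => simp [wallAStar_succ]

theorem eval_zero_wallB (n : ℕ) : (wallB α n).eval 0 = 1 := by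
  induction n with
  | zero => simp [wallB_zero]
  | succ n ih => simp [wallB_succ, ih, eval_zero_wallAStar]

/-- The Pinter–Nevai formulas for the polynomials of the first kind. -/
theorem szegoPoly_eq_wall (n : ℕ) :
    X * szegoPoly α n = X * wallBStar α n - wallAStar α n ∧
      szegoPolyStar α n = wallB α n - X * wallA α n := by
  induction n with
  | zero =>
    simp [szegoPoly, szegoPolyStar_zero, wallA_zero, wallB_zero, wallAStar_zero, wallBStar_zero]
  | succ n ih =>
    obtain ⟨h1, h2⟩ := ih
    rw [szegoPoly_succ, szegoPolyStar_succ, wallA_succ, wallB_succ, wallAStar_succ,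
      wallBStar_succ]
    constructor
    · linear_combination X * h1 - X * C (conj (α n)) * h2
    · linear_combination h2 - C (α n) * h1

theorem wall_neg (n : ℕ) :
    wallA (fun k => -α k) n = -wallA α n ∧ wallB (fun k => -α k) n = wallB α n ∧
      wallAStar (fun k => -α k) n = -wallAStar α n ∧
      wallBStar (fun k => -α k) n = wallBStar α n := by
  suffices h : wallA (fun k => -α k) n = -wallA α n ∧ wallB (fun k => -α k) n = wallB α n from
    ⟨h.1, h.2, by rw [wallAStar, h.1, reversed_neg, wallAStar], by rw [wallBStar, h.2, wallBStar]⟩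
  induction n with
  | zero => simp [wallA_zero, wallB_zero]
  | succ n ih =>
    rw [wallA_succ, wallB_succ, wallAStar, wallBStar, ih.1, ih.2, reversed_neg, wallA_succ,
      wallB_succ, wallAStar, wallBStar]
    simp only [C_neg]
    constructor <;> ring

/-- The Pinter–Nevai formulas for the polynomials of the second kind. -/
theorem secondKindPoly_eq_wall (n : ℕ) :
    X * secondKindPoly α n = X * wallBStar α n + wallAStar α n ∧
      secondKindPolyStar α n = wallB α n + X * wallA α n := by
  have h := szegoPoly_eq_wall (fun k => -α k) n
  obtain ⟨h1, h2, h3, h4⟩ := wall_neg α n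
  rw [h1, h2, h3, h4, sub_neg_eq_add, mul_neg, sub_neg_eq_add] at h
  exact h

/-- Splitting off the first factor of the transfer matrix of the Schur algorithm. -/
theorem wall_succ_left (n : ℕ) :
    wallA α (n + 1) =
        X * wallA (fun k => α (k + 1)) n + C (α 0) * wallB (fun k => α (k + 1)) n ∧
      wallB α (n + 1) =
        C (conj (α 0)) * X * wallA (fun k => α (k + 1)) n + wallB (fun k => α (k + 1)) n ∧
      wallBStar α (n + 1) =
        X * wallBStar (fun k => α (k + 1)) n + C (α 0) * wallAStar (fun k => α (k + 1)) n ∧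
      wallAStar α (n + 1) =
        C (conj (α 0)) * X * wallBStar (fun k => α (k + 1)) n +
          wallAStar (fun k => α (k + 1)) n := by
  -- The recurrence appends matrix factors on the right, so the leftmost factor passes through the
  -- induction untouched: this is associativity of the matrix product.
  induction n with
  | zero =>
    simp only [wallA_succ, wallB_succ, wallAStar_succ, wallBStar_succ, wallA_zero, wallB_zero,
      wallAStar_zero, wallBStar_zero]
    refine ⟨?_, ?_, ?_, ?_⟩ <;> ring
  | succ n ih =>
    obtain ⟨h1, h2, h3, h4⟩ := ih
    rw [wallA_succ α (n + 1), wallB_succ α (n + 1), wallAStar_succ α (n + 1),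
      wallBStar_succ α (n + 1), h1, h2, h3, h4, wallA_succ _ n, wallB_succ _ n,
      wallAStar_succ _ n, wallBStar_succ _ n]
    refine ⟨?_, ?_, ?_, ?_⟩ <;> ring

end Wall

/-! ### The Schur step maps Schur functions to Schur functions. -/

section SchurStep

theorem isSchurFunction_of_differentiableOn {g : ℂ → ℂ} (hd : DifferentiableOn ℂ g unitDisk)
    (hb : ∀ z ∈ unitDisk, ‖g z‖ ≤ 1) : IsSchurFunction g :=
  ⟨hd.analyticOnNhd Metric.isOpen_ball, hb⟩

theorem IsSchurFunction.norm_mul_lt_one {g : ℂ → ℂ} (hg : IsSchurFunction g) {z : ℂ}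
    (hz : z ∈ unitDisk) : ‖z * g z‖ < 1 := by
  rw [norm_mul]
  have h1 : ‖z‖ < 1 := by simpa using hz
  nlinarith [hg.2 z hz, norm_nonneg z, norm_nonneg (g z)]

theorem one_add_conj_mul_ne_zero {a w : ℂ} (ha : ‖a‖ < 1) (hw : ‖w‖ < 1) :
    1 + conj a * w ≠ 0 := by
  intro h
  have h1 : conj a * w = -1 := by linear_combination h
  have h2 : ‖a‖ * ‖w‖ = 1 := by
    rw [← Complex.norm_conj a, ← norm_mul, h1]; simp
  nlinarith [norm_nonneg a, norm_nonneg w]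

theorem norm_moebius_le_one {a w : ℂ} (ha : ‖a‖ < 1) (hw : ‖w‖ < 1) :
    ‖(a + w) / (1 + conj a * w)‖ ≤ 1 := by
  rw [norm_div]
  refine div_le_one_of_le₀ ?_ (norm_nonneg _)
  rw [← sq_le_sq₀ (norm_nonneg _) (norm_nonneg _), ← Complex.normSq_eq_norm_sq,
    ← Complex.normSq_eq_norm_sq]
  have key : Complex.normSq (1 + conj a * w) - Complex.normSq (a + w) =
      (1 - Complex.normSq a) * (1 - Complex.normSq w) := by
    simp [Complex.normSq_apply]; ring
  have h1 : Complex.normSq a < 1 := by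
    rw [Complex.normSq_eq_norm_sq]; nlinarith [norm_nonneg a]
  have h2 : Complex.normSq w < 1 := by
    rw [Complex.normSq_eq_norm_sq]; nlinarith [norm_nonneg w]
  nlinarith [mul_nonneg (sub_nonneg.2 h1.le) (sub_nonneg.2 h2.le)]

theorem IsSchurFunction.schurStep_den_ne_zero {a : ℂ} (ha : ‖a‖ < 1) {g : ℂ → ℂ}
    (hg : IsSchurFunction g) {z : ℂ} (hz : z ∈ unitDisk) : 1 + conj a * z * g z ≠ 0 := by
  rw [mul_assoc]
  exact one_add_conj_mul_ne_zero ha (hg.norm_mul_lt_one hz)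

theorem IsSchurFunction.schurStep {a : ℂ} (ha : ‖a‖ < 1) {g : ℂ → ℂ} (hg : IsSchurFunction g) :
    IsSchurFunction (schurStep a g) := by
  have hd : DifferentiableOn ℂ g unitDisk := hg.1.differentiableOn
  refine isSchurFunction_of_differentiableOn ?_ fun z hz => ?_
  · unfold NonclassicalOPUC.schurStep
    refine DifferentiableOn.div (by fun_prop) (by fun_prop) fun z hz => ?_
    exact hg.schurStep_den_ne_zero ha hz
  · have h := norm_moebius_le_one ha (hg.norm_mul_lt_one hz)
    rwa [← mul_assoc] at h

/-- The Schur step raises the order of contact at the origin of two Schur functions by one. -/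
theorem schurStep_sub_eq_pow_mul {a : ℂ} (ha : ‖a‖ < 1) {g₁ g₂ h : ℂ → ℂ}
    (hg₁ : IsSchurFunction g₁) (hg₂ : IsSchurFunction g₂) (hh : DifferentiableOn ℂ h unitDisk)
    {k : ℕ} (hk : ∀ z ∈ unitDisk, g₁ z - g₂ z = z ^ k * h z) :
    ∃ h' : ℂ → ℂ, DifferentiableOn ℂ h' unitDisk ∧
      ∀ z ∈ unitDisk, schurStep a g₁ z - schurStep a g₂ z = z ^ (k + 1) * h' z := by
  have hd₁ : DifferentiableOn ℂ g₁ unitDisk := hg₁.1.differentiableOn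
  have hd₂ : DifferentiableOn ℂ g₂ unitDisk := hg₂.1.differentiableOn
  -- Over the common denominator, the difference of the two Möbius values has numerator `z (1 -
  -- |a|²)(g₁ - g₂)`; the explicit `z` raises the order.
  refine ⟨fun z => h z * (1 - a * conj a) /
    ((1 + conj a * z * g₁ z) * (1 + conj a * z * g₂ z)), ?_, fun z hz => ?_⟩
  · refine DifferentiableOn.div (by fun_prop) (by fun_prop) fun z hz => ?_
    exact mul_ne_zero (hg₁.schurStep_den_ne_zero ha hz) (hg₂.schurStep_den_ne_zero ha hz)
  · have h1 := hg₁.schurStep_den_ne_zero ha hz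
    have h2 := hg₂.schurStep_den_ne_zero ha hz
    rw [NonclassicalOPUC.schurStep, NonclassicalOPUC.schurStep, div_sub_div _ _ h1 h2,
      ← mul_div_assoc]
    congr 1
    linear_combination z * (1 - a * conj a) * hk z hz

end SchurStep

/-! ### Existence of the Schur function with given coefficients. -/

section Existence

/-- The approximants of the Schur function with coefficients `γ`. -/
noncomputable def schurApprox : ℕ → (ℕ → ℂ) → ℂ → ℂ
  | 0, _ => 0
  | k + 1, γ => schurStep (γ 0) (schurApprox k fun n => γ (n + 1))

theorem isSchurFunction_schurApprox (k : ℕ) {γ : ℕ → ℂ} (hγ : ∀ n, ‖γ n‖ < 1) :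
    IsSchurFunction (schurApprox k γ) := by
  induction k generalizing γ with
  | zero => exact ⟨fun z _ => analyticAt_const, fun z _ => by simp [schurApprox]⟩
  | succ k ih => exact (ih fun n => hγ (n + 1)).schurStep (hγ 0)

theorem schurApprox_succ_sub (k : ℕ) {γ : ℕ → ℂ} (hγ : ∀ n, ‖γ n‖ < 1) :
    ∃ h : ℂ → ℂ, DifferentiableOn ℂ h unitDisk ∧
      ∀ z ∈ unitDisk, schurApprox (k + 1) γ z - schurApprox k γ z = z ^ k * h z := by
  induction k generalizing γ with
  | zero =>
    exact ⟨schurApprox 1 γ, (isSchurFunction_schurApprox 1 hγ).1.differentiableOn,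
      fun z _ => by simp [schurApprox]⟩
  | succ k ih =>
    have hγ' : ∀ n, ‖γ (n + 1)‖ < 1 := fun n => hγ (n + 1)
    obtain ⟨h, hd, hh⟩ := ih hγ'
    exact schurStep_sub_eq_pow_mul (hγ 0) (isSchurFunction_schurApprox (k + 1) hγ')
      (isSchurFunction_schurApprox k hγ') hd hh

/-- Schwarz lemma of higher order: the difference of two Schur functions is bounded by 2 and here
vanishes to order `k` at 0. The geometric bound makes the telescoping series converge locally
uniformly. -/
theorem norm_schurApprox_succ_sub_le (k : ℕ) {γ : ℕ → ℂ} (hγ : ∀ n, ‖γ n‖ < 1) {z : ℂ}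
    (hz : z ∈ unitDisk) : ‖schurApprox (k + 1) γ z - schurApprox k γ z‖ ≤ 2 * ‖z‖ ^ k := by
  have hS := isSchurFunction_schurApprox (k + 1) hγ
  have hS' := isSchurFunction_schurApprox k hγ
  have hb : ∀ w ∈ unitDisk, ‖schurApprox (k + 1) γ w - schurApprox k γ w‖ ≤ 2 := fun w hw =>
    (norm_sub_le _ _).trans (by linarith [hS.2 w hw, hS'.2 w hw])
  obtain ⟨h, hd, hh⟩ := schurApprox_succ_sub k hγ
  have h0 : (0 : ℂ) ∈ unitDisk := by simp
  cases k with
  | zero => simpa using hb z hz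
  | succ k =>
    set f : ℂ → ℂ := fun w => schurApprox (k + 1 + 1) γ w - schurApprox (k + 1) γ w with hf
    have hf0 : f 0 = 0 := by simp [hf, hh 0 h0]
    have hfd : DifferentiableOn ℂ f unitDisk :=
      hS.1.differentiableOn.sub hS'.1.differentiableOn
    -- Here the order of vanishing is `k + 1`; being `o(‖w‖ ^ k)` is what the Schwarz estimate with
    -- exponent `k + 1` requires.
    have hlo : (f · - f 0) =o[𝓝 0] fun w : ℂ => ‖w - 0‖ ^ k := by
      have hev : (f · - f 0) =ᶠ[𝓝 0] fun w => w ^ k * (w * h w) := by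
        filter_upwards [Metric.ball_mem_nhds (0 : ℂ) one_pos] with w hw
        rw [hf0, sub_zero, hf]
        simp only
        rw [hh w hw]
        ring
      refine hev.trans_isLittleO ?_
      have hc : ContinuousAt h 0 :=
        (hd.differentiableAt (Metric.ball_mem_nhds (0 : ℂ) one_pos)).continuousAt
      have ht : Tendsto (fun w => w * h w) (𝓝 0) (𝓝 0) := by
        simpa using (continuous_id.tendsto (0 : ℂ)).mul hc.tendsto
      have := (Asymptotics.isBigO_refl (fun w : ℂ => w ^ k) (𝓝 0)).mul_isLittleO
        ((Asymptotics.isLittleO_one_iff ℂ).2 ht)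
      simpa using this.norm_right
    have hmaps : Set.MapsTo f unitDisk (Metric.closedBall (f 0) 2) := fun w hw => by
      rw [hf0, mem_closedBall_zero_iff]
      exact hb w hw
    have key := Complex.dist_le_mul_div_pow_of_mapsTo_ball_of_isLittleO hfd hmaps hlo hz
    simpa [hf0] using key

/-- The limit of the approximants. -/
noncomputable def schurLimit (γ : ℕ → ℂ) (z : ℂ) : ℂ :=
  ∑' k, (schurApprox (k + 1) γ z - schurApprox k γ z)

theorem tendsto_schurApprox {γ : ℕ → ℂ} (hγ : ∀ n, ‖γ n‖ < 1) {z : ℂ} (hz : z ∈ unitDisk) :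
    Tendsto (fun k => schurApprox k γ z) atTop (𝓝 (schurLimit γ z)) := by
  have hz1 : ‖z‖ < 1 := by simpa using hz
  have hs : Summable fun k => schurApprox (k + 1) γ z - schurApprox k γ z :=
    Summable.of_norm_bounded ((summable_geometric_of_lt_one (norm_nonneg z) hz1).mul_left 2)
      fun k => norm_schurApprox_succ_sub_le k hγ hz
  refine hs.hasSum.tendsto_sum_nat.congr fun k => ?_
  rw [Finset.sum_range_sub fun k => schurApprox k γ z]
  simp [schurApprox]

theorem isSchurFunction_schurLimit {γ : ℕ → ℂ} (hγ : ∀ n, ‖γ n‖ < 1) :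
    IsSchurFunction (schurLimit γ) := by
  refine isSchurFunction_of_differentiableOn (fun z hz => ?_) fun z hz => ?_
  · have hz1 : ‖z‖ < 1 := by simpa using hz
    obtain ⟨r, hzr, hr1⟩ := exists_between hz1
    have hr0 : 0 ≤ r := (norm_nonneg z).trans hzr.le
    have hsub : Metric.ball (0 : ℂ) r ⊆ unitDisk := Metric.ball_subset_ball hr1.le
    have hd : DifferentiableOn ℂ (schurLimit γ) (Metric.ball 0 r) := by
      refine Complex.differentiableOn_tsum_of_summable_norm
        (u := fun k => 2 * r ^ k) ((summable_geometric_of_lt_one hr0 hr1).mul_left 2)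
        (fun k => ?_) Metric.isOpen_ball fun k w hw => ?_
      · exact ((isSchurFunction_schurApprox (k + 1) hγ).1.differentiableOn.sub
          (isSchurFunction_schurApprox k hγ).1.differentiableOn).mono hsub
      · refine (norm_schurApprox_succ_sub_le k hγ (hsub hw)).trans ?_
        have : ‖w‖ ≤ r := (by simpa using hw : ‖w‖ < r).le
        gcongr
    exact (hd.differentiableAt
      (Metric.isOpen_ball.mem_nhds (by simpa using hzr))).differentiableWithinAt
  · exact le_of_tendsto (tendsto_schurApprox hγ hz).norm
      (Eventually.of_forall fun k => (isSchurFunction_schurApprox k hγ).2 z hz)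

theorem schurLimit_eq_schurStep {γ : ℕ → ℂ} (hγ : ∀ n, ‖γ n‖ < 1) {z : ℂ} (hz : z ∈ unitDisk) :
    schurLimit γ z = schurStep (γ 0) (schurLimit fun n => γ (n + 1)) z := by
  have hγ' : ∀ n, ‖γ (n + 1)‖ < 1 := fun n => hγ (n + 1)
  have ht := tendsto_schurApprox hγ' hz
  have hne := (isSchurFunction_schurLimit hγ').schurStep_den_ne_zero (hγ 0) hz
  refine tendsto_nhds_unique ((tendsto_add_atTop_iff_nat 1).2 (tendsto_schurApprox hγ hz)) ?_
  exact ((tendsto_const_nhds.add (ht.const_mul z)).div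
    (tendsto_const_nhds.add (ht.const_mul (conj (γ 0) * z))) hne)

theorem exists_isSchurFunctionOf {γ : ℕ → ℂ} (hγ : ∀ n, ‖γ n‖ < 1) :
    ∃ f : ℂ → ℂ, IsSchurFunctionOf γ f := by
  refine ⟨_, fun n => schurLimit fun k => γ (n + k), rfl,
    fun n => isSchurFunction_schurLimit fun k => hγ _, fun n z hz => ?_⟩
  have h := schurLimit_eq_schurStep (γ := fun k => γ (n + k)) (fun k => hγ _) hz
  simpa only [add_zero, add_assoc, add_comm 1] using h

end Existence

/-! ### Comparing numbers of zeros without strict inequality on the circle. -/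

section ZeroCount

/-- The monic polynomial with the given roots. -/
noncomputable def rootPoly (s : Multiset ℂ) : ℂ[X] := (s.map fun a => X - C a).prod

/-- The reflection of `rootPoly s` in the circle of radius `r`. -/
noncomputable def reflPoly (r : ℝ) (s : Multiset ℂ) : ℂ[X] :=
  (s.map fun a => C ((r : ℂ) ^ 2) - C (conj a) * X).prod

theorem rootPoly_zero : rootPoly 0 = 1 := by simp [rootPoly]

theorem rootPoly_cons (a : ℂ) (s : Multiset ℂ) :
    rootPoly (a ::ₘ s) = (X - C a) * rootPoly s := by simp [rootPoly]

theorem rootPoly_add (s t : Multiset ℂ) : rootPoly (s + t) = rootPoly s * rootPoly t := by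
  simp [rootPoly]

theorem rootPoly_replicate (n : ℕ) (a : ℂ) : rootPoly (Multiset.replicate n a) = (X - C a) ^ n := by
  simp [rootPoly]

theorem eval_rootPoly_eq_zero_iff {s : Multiset ℂ} {z : ℂ} :
    (rootPoly s).eval z = 0 ↔ z ∈ s := by
  induction s using Multiset.induction with
  | empty => simp [rootPoly_zero]
  | cons a s ih => simp [rootPoly_cons, ih, sub_eq_zero]

theorem reflPoly_cons (r : ℝ) (a : ℂ) (s : Multiset ℂ) :
    reflPoly r (a ::ₘ s) = (C ((r : ℂ) ^ 2) - C (conj a) * X) * reflPoly r s := by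
  simp [reflPoly]

theorem eval_reflPoly_of_norm_eq {r : ℝ} {z : ℂ} (hz : ‖z‖ = r) (s : Multiset ℂ) :
    (reflPoly r s).eval z = conj ((rootPoly s).eval z) * z ^ s.card := by
  induction s using Multiset.induction with
  | empty => simp [reflPoly, rootPoly]
  | cons a s ih =>
    have hzz : z * conj z = (r : ℂ) ^ 2 := by
      rw [Complex.mul_conj, Complex.normSq_eq_norm_sq, hz]; simp
    rw [reflPoly_cons, rootPoly_cons, Multiset.card_cons]
    simp only [eval_mul, eval_sub, eval_C, eval_X, ih, map_mul, map_sub]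
    rw [← hzz]
    ring

theorem eval_reflPoly_ne_zero {r : ℝ} {s : Multiset ℂ} (hs : ∀ a ∈ s, ‖a‖ < r) {z : ℂ}
    (hz : ‖z‖ ≤ r) (hr : 0 < r) : (reflPoly r s).eval z ≠ 0 := by
  induction s using Multiset.induction with
  | empty => simp [reflPoly]
  | cons a s ih =>
    rw [reflPoly_cons, eval_mul]
    refine mul_ne_zero ?_ (ih fun b hb => hs b (Multiset.mem_cons_of_mem hb))
    intro h
    simp only [eval_sub, eval_mul, eval_C, eval_X, sub_eq_zero] at h
    have h1 := congrArg norm h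
    rw [norm_pow, norm_mul, Complex.norm_conj, Complex.norm_real, Real.norm_of_nonneg hr.le] at h1
    have h2 := hs a (Multiset.mem_cons_self a s)
    nlinarith [norm_nonneg a, norm_nonneg z]

/-- A neighbourhood of the unit circle contains the circles of radius close to one. -/
theorem eventually_sphere_subset {U : Set ℂ} (hU : IsOpen U) (h : Metric.sphere (0 : ℂ) 1 ⊆ U) :
    ∀ᶠ r : ℝ in 𝓝[<] 1, Metric.sphere (0 : ℂ) r ⊆ U := by
  obtain ⟨δ, hδ, hsub⟩ := (isCompact_sphere (0 : ℂ) 1).exists_thickening_subset_open hU h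
  have h1 : ∀ᶠ r : ℝ in 𝓝[<] 1, r ∈ Set.Ioo (max 0 (1 - δ)) 1 :=
    Ioo_mem_nhdsLT (max_lt one_pos (by linarith))
  filter_upwards [h1] with r hr z hz
  have hr0 : 0 < r := (le_max_left _ _).trans_lt hr.1
  have hr1 : 1 - δ < r := (le_max_right _ _).trans_lt hr.1
  have hz' : ‖z‖ = r := by simpa using hz
  -- The radial projection of `z` to the unit circle lies at distance `1 - r < δ` from it.
  refine hsub (Metric.mem_thickening_iff.2 ⟨z / r, ?_, ?_⟩)
  · simp [hz', abs_of_pos hr0, hr0.ne']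
  · have hrc : (r : ℂ) ≠ 0 := by exact_mod_cast hr0.ne'
    have : z - z / r = z / r * ((r - 1 : ℝ) : ℂ) := by
      push_cast
      field_simp
    rw [dist_eq_norm, this, norm_mul, norm_div, Complex.norm_real, Complex.norm_real, hz',
      Real.norm_of_nonneg hr0.le, div_self hr0.ne', Real.norm_of_nonpos (by linarith [hr.2])]
    linarith

/-- The pointwise estimate behind `card_le_card_of_sub_mul_eq_rootPoly_mul`. -/
theorem norm_sub_sq_le {p q f : ℂ} {ε : ℝ} (hp : p ≠ 0) (hf : ‖f‖ ≤ 1)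
    (hq : ‖q‖ ^ 2 ≤ (1 + ε) * ‖p‖ ^ 2) :
    ‖(p - q * f) / p‖ ^ 2 ≤ 2 * ((p - q * f) / p).re + ε := by
  -- With `u = 1 - g`, expanding `‖g‖² = 1 - 2 Re u + ‖u‖²` turns `‖g‖² ≤ 1 + ε` into the claim.
  have hu : (p - q * f) / p = 1 - q * f / p := by field_simp
  have hp' : 0 < ‖p‖ ^ 2 := by positivity
  have hg : ‖q * f / p‖ ^ 2 ≤ 1 + ε := by
    rw [norm_div, norm_mul, div_pow, mul_pow, div_le_iff₀ hp']
    have : ‖f‖ ^ 2 ≤ 1 := pow_le_one₀ (norm_nonneg _) hf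
    nlinarith [sq_nonneg ‖q‖]
  rw [hu]
  generalize q * f / p = g at hg ⊢
  rw [← Complex.normSq_eq_norm_sq, Complex.normSq_apply] at *
  simp only [Complex.sub_re, Complex.sub_im, Complex.one_re, Complex.one_im]
  nlinarith

/-- If `‖q‖ = ‖p‖` on the unit circle and `f` is a Schur function, then `p - q f` has in the disk
no more zeros than `p`. -/
theorem card_le_card_of_sub_mul_eq_rootPoly_mul {p q b : ℂ[X]} {s t : Multiset ℂ} {f S : ℂ → ℂ}
    (hp : p = rootPoly s * b) (hs : ∀ a ∈ s, ‖a‖ < 1) (hb : ∀ z : ℂ, ‖z‖ ≤ 1 → b.eval z ≠ 0)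
    (hq : ∀ z : ℂ, ‖z‖ = 1 → ‖q.eval z‖ = ‖p.eval z‖) (hf : IsSchurFunction f)
    (h0 : p.eval 0 - q.eval 0 * f 0 = 1) (ht : ∀ a ∈ t, ‖a‖ < 1)
    (hS : DifferentiableOn ℂ S unitDisk)
    (hfac : ∀ z ∈ unitDisk, p.eval z - q.eval z * f z = (rootPoly t).eval z * S z) :
    t.card ≤ s.card := by
  by_contra! hcard
  have hroot : ∀ {u : Multiset ℂ}, (∀ a ∈ u, ‖a‖ < 1) → ∀ z : ℂ, ‖z‖ = 1 →
      (rootPoly u).eval z ≠ 0 := fun hu z hz h =>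
    (hu z (eval_rootPoly_eq_zero_iff.1 h)).ne hz
  obtain ⟨K₀, hK₀⟩ := (isCompact_closedBall (0 : ℂ) 1).exists_bound_of_continuousOn
    (f := fun z => b.eval z * (rootPoly t).eval z) (by fun_prop)
  obtain ⟨C₀, hC₀⟩ := (isCompact_sphere (0 : ℂ) 1).exists_bound_of_continuousOn
    (f := fun z => (rootPoly s).eval z / (rootPoly t).eval z)
    (ContinuousOn.div (by fun_prop) (by fun_prop) fun z hz => hroot ht z (by simpa using hz))
  have hC₀0 : 0 ≤ C₀ := (norm_nonneg _).trans (hC₀ 1 (by simp))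
  set M : ℝ := C₀ + 1 with hM
  set K : ℝ := K₀ ^ 2 + 1 with hK
  have hM0 : 0 < M := by positivity
  have hK0 : 0 < K := by positivity
  -- The total error on the circle will be at most `K M² ε = 1/2`, strictly below `R(0)² = 1`.
  set ε : ℝ := 1 / (2 * K * M ^ 2) with hε
  have hε0 : 0 < ε := by positivity
  have hεK : K * M ^ 2 * ε = 1 / 2 := by rw [hε]; field_simp
  have hU₁ : ∀ᶠ r : ℝ in 𝓝[<] 1, Metric.sphere (0 : ℂ) r ⊆
      {z | ‖q.eval z‖ ^ 2 < (1 + ε) * ‖p.eval z‖ ^ 2} := by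
    refine eventually_sphere_subset (isOpen_lt (by fun_prop) (by fun_prop)) fun z hz => ?_
    have hz1 : ‖z‖ = 1 := by simpa using hz
    have hpz : p.eval z ≠ 0 := by
      rw [hp, eval_mul]
      exact mul_ne_zero (hroot hs z hz1) (hb z hz1.le)
    have : 0 < ‖p.eval z‖ ^ 2 := by positivity
    rw [Set.mem_ofPred_eq, hq z hz1]
    nlinarith
  have hU₂ : ∀ᶠ r : ℝ in 𝓝[<] 1, Metric.sphere (0 : ℂ) r ⊆
      {z | ‖(rootPoly s).eval z‖ < M * ‖(rootPoly t).eval z‖} := by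
    refine eventually_sphere_subset (isOpen_lt (by fun_prop) (by fun_prop)) fun z hz => ?_
    have hP : 0 < ‖(rootPoly t).eval z‖ := norm_pos_iff.2 (hroot ht z (by simpa using hz))
    have := hC₀ z hz
    rw [norm_div, div_le_iff₀ hP] at this
    rw [Set.mem_ofPred_eq]
    nlinarith
  -- With all points of `t` inside radius `r`, the reflected polynomial in the denominator of `H`
  -- has no zeros in the closed disk of radius `r`.
  have hU₃ : ∀ᶠ r : ℝ in 𝓝[<] 1, ∀ a ∈ t.toFinset, ‖a‖ < r :=
    (Filter.eventually_all_finset _).2 fun a ha => by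
      filter_upwards [Ioo_mem_nhdsLT (ht a (Multiset.mem_toFinset.1 ha))] with r hr using hr.1
  obtain ⟨r, hr₁, hr₂, hr₃, hr0, hr1⟩ :=
    (hU₁.and (hU₂.and (hU₃.and (Ioo_mem_nhdsLT (one_pos (α := ℝ)))))).exists
  have htr : ∀ a ∈ t, ‖a‖ < r := fun a ha => hr₃ a (Multiset.mem_toFinset.2 ha)
  have hsub : Metric.closedBall (0 : ℂ) r ⊆ unitDisk := Metric.closedBall_subset_ball hr1
  -- On `‖z‖ = r` reflection is conjugation up to a power of `z`, and the powers cancel; thus `H =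
  -- (R/p) ‖A‖²/‖P‖²` there, with `A = rootPoly s` and `P = rootPoly t`. Inside, `H` is holomorphic,
  -- and the surplus `t.card - s.card > 0` makes it vanish at 0.
  set H : ℂ → ℂ := fun z => S z / b.eval z *
    (z ^ (t.card - s.card) * (reflPoly r s).eval z / (reflPoly r t).eval z) with hH
  set R : ℂ → ℂ := fun z => p.eval z - q.eval z * f z with hR
  have hest : ∀ z : ℂ, ‖z‖ = r → (R z ^ 2 - 2 * K * H z).re ≤ 1 / 2 := by
    intro z hz
    have hzs : z ∈ Metric.sphere (0 : ℂ) r := by simpa using hz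
    have hzU : z ∈ unitDisk := hsub (Metric.sphere_subset_closedBall hzs)
    have hz1 : ‖z‖ ≤ 1 := hz.le.trans hr1.le
    have hz0 : z ≠ 0 := by rintro rfl; simp at hz; exact hr0.ne hz
    have h₁ : ‖q.eval z‖ ^ 2 < (1 + ε) * ‖p.eval z‖ ^ 2 := hr₁ hzs
    have h₂ : ‖(rootPoly s).eval z‖ < M * ‖(rootPoly t).eval z‖ := hr₂ hzs
    have hpz : p.eval z ≠ 0 := fun h => by
      rw [h] at h₁
      simp at h₁
      exact absurd h₁ (not_lt.2 (by positivity))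
    have hPz : (rootPoly t).eval z ≠ 0 := fun h => by
      rw [h] at h₂
      simp at h₂
      exact absurd h₂ (not_lt.2 (norm_nonneg _))
    have hbz := hb z hz1
    have hpe : p.eval z = (rootPoly s).eval z * b.eval z := by rw [hp, eval_mul]
    have hAz : (rootPoly s).eval z ≠ 0 := fun h => hpz (by rw [hpe, h, zero_mul])
    have key := norm_sub_sq_le hpz (hf.2 z hzU) h₁.le
    set u : ℂ := (p.eval z - q.eval z * f z) / p.eval z with hu
    set W : ℝ := ‖(rootPoly s).eval z‖ ^ 2 / ‖(rootPoly t).eval z‖ ^ 2 with hW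
    have hRz : R z = p.eval z * u := by rw [hR, hu]; field_simp
    have hHz : H z = u * (W : ℂ) := by
      have hWc : (W : ℂ) = ((rootPoly s).eval z * conj ((rootPoly s).eval z)) /
          ((rootPoly t).eval z * conj ((rootPoly t).eval z)) := by
        rw [Complex.mul_conj, Complex.mul_conj, Complex.normSq_eq_norm_sq,
          Complex.normSq_eq_norm_sq, hW]
        push_cast
        rfl
      have hcP : conj ((rootPoly t).eval z) ≠ 0 := by simpa using hPz
      have hpow : z ^ t.card = z ^ (t.card - s.card) * z ^ s.card := by
        rw [← pow_add, Nat.sub_add_cancel hcard.le]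
      simp only [hH]
      rw [hu, hfac z hzU, hpe, hWc, eval_reflPoly_of_norm_eq hz, eval_reflPoly_of_norm_eq hz, hpow]
      field_simp
    have hPp : 0 < ‖(rootPoly t).eval z‖ := norm_pos_iff.2 hPz
    have hWM : W ≤ M ^ 2 := by
      rw [hW, div_le_iff₀ (by positivity), ← mul_pow]
      gcongr
    have hW0 : 0 ≤ W := by positivity
    have hKz : ‖b.eval z * (rootPoly t).eval z‖ ^ 2 ≤ K := by
      have := hK₀ z (by simpa using hz1)
      have h' : ‖b.eval z * (rootPoly t).eval z‖ ^ 2 ≤ K₀ ^ 2 := by gcongr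
      linarith
    have hnp : ‖p.eval z‖ ^ 2 = W * ‖b.eval z * (rootPoly t).eval z‖ ^ 2 := by
      rw [hpe, hW, norm_mul, norm_mul]
      field_simp
    have hnR : ‖R z‖ ^ 2 ≤ 2 * K * (u.re * W) + 1 / 2 := by
      have hnn : 0 ≤ 2 * u.re + ε := (sq_nonneg _).trans key
      calc ‖R z‖ ^ 2 = W * (‖b.eval z * (rootPoly t).eval z‖ ^ 2 * ‖u‖ ^ 2) := by
            rw [hRz, norm_mul, mul_pow, hnp]; ring
        _ ≤ W * (K * (2 * u.re + ε)) := by gcongr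
        _ = 2 * K * (u.re * W) + K * W * ε := by ring
        _ ≤ 2 * K * (u.re * W) + K * M ^ 2 * ε := by gcongr
        _ = _ := by rw [hεK]
    have hre : (2 * K * H z).re = 2 * K * (u.re * W) := by
      rw [hHz]
      have : (2 * K * (u * W) : ℂ) = ((2 * K * W : ℝ) : ℂ) * u := by push_cast; ring
      rw [this, Complex.re_ofReal_mul]
      ring
    have hre2 : (R z ^ 2).re ≤ ‖R z‖ ^ 2 := by
      rw [← norm_pow]
      exact Complex.re_le_norm _
    rw [Complex.sub_re, hre]
    linarith
  have hHd : DifferentiableOn ℂ H (Metric.closedBall 0 r) := by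
    have hS' := hS.mono hsub
    refine DifferentiableOn.mul (hS'.div (by fun_prop) fun z hz => hb z ?_)
      (DifferentiableOn.div (by fun_prop) (by fun_prop) fun z hz =>
        eval_reflPoly_ne_zero htr (by simpa using hz) hr0)
    exact (by simpa using hz : ‖z‖ ≤ r).trans hr1.le
  have hRd : DifferentiableOn ℂ R (Metric.closedBall 0 r) := by
    have hf' : DifferentiableOn ℂ f (Metric.closedBall 0 r) := hf.1.differentiableOn.mono hsub
    simp only [hR]
    fun_prop
  -- Exponentiating turns the bound on a real part into a bound on a modulus, so the maximum modulus
  -- principle carries it to the centre.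
  have hφ : DiffContOnCl ℂ (fun z => Complex.exp (R z ^ 2 - 2 * K * H z)) (Metric.ball 0 r) := by
    refine DifferentiableOn.diffContOnCl ?_
    rw [closure_ball _ hr0.ne']
    fun_prop
  have hmax := Complex.norm_le_of_forall_mem_frontier_norm_le Metric.isBounded_ball hφ
    (C := Real.exp (1 / 2)) (fun z hz => by
      rw [frontier_ball _ hr0.ne'] at hz
      rw [Complex.norm_exp]
      exact Real.exp_le_exp.2 (hest z (by simpa using hz)))
    (subset_closure (Metric.mem_ball_self hr0))
  have hH0 : H 0 = 0 := by
    simp only [hH]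
    rw [zero_pow (Nat.sub_ne_zero_of_lt hcard)]
    simp
  have hR0 : R 0 = 1 := h0
  rw [Complex.norm_exp, hH0, hR0] at hmax
  have := Real.exp_le_exp.1 hmax
  norm_num at this

/-- The quotient by `(z - a) ^ k` has a removable singularity at `a`, filled with the value of the
local cofactor. -/
theorem exists_eq_pow_mul {g : ℂ → ℂ} (hg : AnalyticOnNhd ℂ g unitDisk) {a : ℂ}
    (ha : a ∈ unitDisk) {k : ℕ} (hk : (k : ℕ∞) ≤ analyticOrderAt g a) :
    ∃ S : ℂ → ℂ, AnalyticOnNhd ℂ S unitDisk ∧ ∀ z ∈ unitDisk, g z = (z - a) ^ k * S z := by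
  obtain ⟨h, hh, hgh⟩ := (natCast_le_analyticOrderAt (hg a ha)).1 hk
  refine ⟨Function.update (fun z => g z / (z - a) ^ k) a (h a), fun b hb => ?_, fun z hz => ?_⟩
  · rcases eq_or_ne b a with rfl | hba
    · refine hh.congr ?_
      filter_upwards [hgh] with z hz
      rcases eq_or_ne z b with rfl | hzb
      · simp
      · rw [Function.update_of_ne hzb, hz, smul_eq_mul,
          mul_div_cancel_left₀ _ (pow_ne_zero k (sub_ne_zero.2 hzb))]
    · have hq : AnalyticAt ℂ (fun z => g z / (z - a) ^ k) b :=
        (hg b hb).div (by fun_prop) (pow_ne_zero k (sub_ne_zero.2 hba))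
      refine hq.congr ?_
      filter_upwards [isOpen_ne.mem_nhds hba] with z hz
      rw [Function.update_of_ne hz]
  · rcases eq_or_ne z a with rfl | hza
    · simpa using hgh.self_of_nhds
    · rw [Function.update_of_ne hza, mul_div_cancel₀ _ (pow_ne_zero k (sub_ne_zero.2 hza))]

/-- Extracting finitely many zeros of an analytic function in the disk. -/
theorem exists_eq_rootPoly_mul (Z : Finset ℂ) (e : ℂ → ℕ) (hZ : ∀ a ∈ Z, a ∈ unitDisk)
    {g : ℂ → ℂ} (hg : AnalyticOnNhd ℂ g unitDisk)
    (he : ∀ a ∈ Z, (e a : ℕ∞) ≤ analyticOrderAt g a) :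
    ∃ S : ℂ → ℂ, DifferentiableOn ℂ S unitDisk ∧ ∀ z ∈ unitDisk,
      g z = (rootPoly (∑ a ∈ Z, Multiset.replicate (e a) a)).eval z * S z := by
  classical
  induction Z using Finset.induction_on generalizing g with
  | empty => exact ⟨g, hg.differentiableOn, fun z _ => by simp [rootPoly_zero]⟩
  | insert a Z ha ih =>
    have haD := hZ a (Finset.mem_insert_self a Z)
    obtain ⟨S, hS, hgS⟩ := exists_eq_pow_mul hg haD (he a (Finset.mem_insert_self a Z))
    -- The factor removed at `a` is nonzero at `b`, so the order at `b` is unchanged.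
    have horder : ∀ b ∈ Z, (e b : ℕ∞) ≤ analyticOrderAt S b := fun b hb => by
      have hbD := hZ b (Finset.mem_insert_of_mem hb)
      have hba : b - a ≠ 0 := sub_ne_zero.2 fun h => ha (h ▸ hb)
      have hpow : AnalyticAt ℂ (fun z => (z - a) ^ e a) b := by fun_prop
      have h1 : g =ᶠ[𝓝 b] (fun z => (z - a) ^ e a) * S := by
        filter_upwards [Metric.isOpen_ball.mem_nhds hbD] with z hz using hgS z hz
      have h2 := he b (Finset.mem_insert_of_mem hb)
      rwa [analyticOrderAt_congr h1, analyticOrderAt_mul hpow (hS b hbD),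
        hpow.analyticOrderAt_eq_zero.2 (pow_ne_zero _ hba), zero_add] at h2
    obtain ⟨T, hT, hST⟩ := ih (fun b hb => hZ b (Finset.mem_insert_of_mem hb)) hS horder
    refine ⟨T, hT, fun z hz => ?_⟩
    rw [Finset.sum_insert ha, rootPoly_add, rootPoly_replicate, hgS z hz, hST z hz]
    simp [mul_assoc]

/-- A polynomial without zeros on the unit circle splits off its zeros in the disk. -/
theorem exists_eq_rootPoly_filter_mul {p : ℂ[X]} (hp : p ≠ 0)
    (hp1 : ∀ z : ℂ, ‖z‖ = 1 → p.eval z ≠ 0) :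
    ∃ (s : Multiset ℂ) (b : ℂ[X]), s.card = numZerosInDisk p ∧ (∀ a ∈ s, ‖a‖ < 1) ∧
      p = rootPoly s * b ∧ ∀ z : ℂ, ‖z‖ ≤ 1 → b.eval z ≠ 0 := by
  classical
  refine ⟨p.roots.filter fun z => z ∈ unitDisk,
    rootPoly (p.roots.filter fun z => z ∉ unitDisk) * C p.leadingCoeff, ?_, ?_, ?_, ?_⟩
  · rw [numZerosInDisk]
  · intro a ha
    simpa using (Multiset.mem_filter.1 ha).2
  · rw [← mul_assoc, ← rootPoly_add, Multiset.filter_add_not, mul_comm]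
    exact (IsAlgClosed.splits p).eq_prod_roots
  · intro z hz
    rw [eval_mul, eval_C]
    refine mul_ne_zero (fun h => ?_) (leadingCoeff_ne_zero.2 hp)
    obtain ⟨hroot, hz'⟩ := Multiset.mem_filter.1 (eval_rootPoly_eq_zero_iff.1 h)
    have hz1 : 1 ≤ ‖z‖ := by simpa using hz'
    exact hp1 z (le_antisymm hz hz1) (isRoot_of_mem_roots hroot)

end ZeroCount

/-! ### Identities off a discrete set. -/

section Codiscrete

theorem zero_mem_unitDisk : (0 : ℂ) ∈ unitDisk := by simp

theorem eventually_codiscreteWithin_ne_zero {g : ℂ → ℂ} (hg : AnalyticOnNhd ℂ g unitDisk)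
    (h0 : g 0 ≠ 0) : ∀ᶠ z in codiscreteWithin unitDisk, g z ≠ 0 :=
  hg.preimage_zero_mem_codiscreteWithin h0 zero_mem_unitDisk
    (Metric.isConnected_ball one_pos)

theorem eventually_nhdsNE_of_codiscreteWithin {P : ℂ → Prop}
    (h : ∀ᶠ z in codiscreteWithin unitDisk, P z) {z : ℂ} (hz : z ∈ unitDisk) :
    ∀ᶠ w in 𝓝[≠] z, P w := by
  have h1 := mem_codiscreteWithin_iff_forall_mem_nhdsNE.1 h z hz
  filter_upwards [h1, nhdsWithin_le_nhds (Metric.isOpen_ball.mem_nhds hz)] with w hw hwD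
  exact hw.resolve_right fun h => h hwD

end Codiscrete

/-! ### The Wall transform and the quotient representing `F`. -/

section WallTransform

variable (α : ℕ → ℂ) (N : ℕ) (g : ℂ → ℂ)

/-- The numerator of `wallTransform`. -/
noncomputable def wallNum (z : ℂ) : ℂ := (wallA α N).eval z + (wallBStar α N).eval z * g z

/-- The denominator of `wallTransform`. -/
noncomputable def wallDen (z : ℂ) : ℂ := (wallB α N).eval z + (wallAStar α N).eval z * g z

theorem wallTransform_eq (z : ℂ) : wallTransform α N g z = wallNum α N g z / wallDen α N g z := rfl

theorem wallTransform_zero : wallTransform α 0 g = g := by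
  ext z
  simp [wallTransform_eq, wallNum, wallDen, wallA_zero, wallB_zero, wallAStar_zero, wallBStar_zero]

theorem wallDen_apply_zero : wallDen α N g 0 = 1 := by
  simp [wallDen, eval_zero_wallB, eval_zero_wallAStar]

theorem analyticOnNhd_eval (p : ℂ[X]) (s : Set ℂ) : AnalyticOnNhd ℂ (fun z => p.eval z) s :=
  AnalyticOnNhd.mono (p.differentiable.differentiableOn.analyticOnNhd isOpen_univ)
    (Set.subset_univ s)

variable {g} in
theorem analyticOnNhd_wallNum (hg : AnalyticOnNhd ℂ g unitDisk) :
    AnalyticOnNhd ℂ (wallNum α N g) unitDisk :=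
  (analyticOnNhd_eval _ _).add ((analyticOnNhd_eval _ _).mul hg)

variable {g} in
theorem analyticOnNhd_wallDen (hg : AnalyticOnNhd ℂ g unitDisk) :
    AnalyticOnNhd ℂ (wallDen α N g) unitDisk :=
  (analyticOnNhd_eval _ _).add ((analyticOnNhd_eval _ _).mul hg)

variable {g} in
theorem meromorphicOn_wallTransform (hg : AnalyticOnNhd ℂ g unitDisk) :
    MeromorphicOn (wallTransform α N g) unitDisk := fun z hz =>
  ((analyticOnNhd_wallNum α N hg) z hz).meromorphicAt.div
    ((analyticOnNhd_wallDen α N hg) z hz).meromorphicAt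

variable {g} in
theorem analyticAt_wallTransform_zero (hg : AnalyticOnNhd ℂ g unitDisk) :
    AnalyticAt ℂ (wallTransform α N g) 0 :=
  ((analyticOnNhd_wallNum α N hg) 0 zero_mem_unitDisk).div
    ((analyticOnNhd_wallDen α N hg) 0 zero_mem_unitDisk)
    (ne_of_eq_of_ne (wallDen_apply_zero α N g) one_ne_zero)

variable {g} in
theorem eventually_wallDen_ne_zero (hg : AnalyticOnNhd ℂ g unitDisk) :
    ∀ᶠ z in codiscreteWithin unitDisk, wallDen α N g z ≠ 0 :=
  eventually_codiscreteWithin_ne_zero (analyticOnNhd_wallDen α N hg)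
    ((wallDen_apply_zero α N g).symm ▸ one_ne_zero)

-- The equality comes from clearing the inner denominator. That denominator may vanish in the disk,
-- since the coefficients may exceed 1 in modulus; but it equals 1 at 0, so its zeros are isolated
-- and are the only points left out.
variable {g} in
theorem wallTransform_succ_eventuallyEq (hg : AnalyticOnNhd ℂ g unitDisk) :
    wallTransform α (N + 1) g =ᶠ[codiscreteWithin unitDisk]
      schurStep (α 0) (wallTransform (fun k => α (k + 1)) N g) := by
  filter_upwards [eventually_wallDen_ne_zero (fun k => α (k + 1)) N hg] with z hz
  obtain ⟨h1, h2, h3, h4⟩ := wall_succ_left α N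
  have hn : wallNum α (N + 1) g z = α 0 * wallDen (fun k => α (k + 1)) N g z +
      z * wallNum (fun k => α (k + 1)) N g z := by
    simp only [wallNum, wallDen, h1, h3, eval_add, eval_mul, eval_C, eval_X]
    ring
  have hd : wallDen α (N + 1) g z = wallDen (fun k => α (k + 1)) N g z +
      conj (α 0) * z * wallNum (fun k => α (k + 1)) N g z := by
    simp only [wallNum, wallDen, h2, h4, eval_add, eval_mul, eval_C, eval_X]
    ring
  rw [schurStep, wallTransform_eq, wallTransform_eq, hn, hd]
  rw [← mul_div_mul_right (α 0 + _) _ hz, add_mul, add_mul, one_mul, mul_assoc z,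
    mul_assoc (conj (α 0) * z), div_mul_cancel₀ _ hz]

/-- The numerator of the Carathéodory function, `Ψ_N^* + z Ψ_N g`. -/
noncomputable def caratheodoryNum (z : ℂ) : ℂ :=
  (secondKindPolyStar α N).eval z + z * (secondKindPoly α N).eval z * g z

/-- The denominator of the Carathéodory function, `Φ_N^* - z Φ_N g`. -/
noncomputable def caratheodoryDen (z : ℂ) : ℂ :=
  (szegoPolyStar α N).eval z - z * (szegoPoly α N).eval z * g z

theorem wallDen_add (z : ℂ) :
    wallDen α N g z + z * wallNum α N g z = caratheodoryNum α N g z := by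
  obtain ⟨h1, h2⟩ := secondKindPoly_eq_wall α N
  have h1' := congrArg (eval z) h1
  have h2' := congrArg (eval z) h2
  simp only [eval_add, eval_mul, eval_X] at h1' h2'
  rw [caratheodoryNum, wallDen, wallNum]
  linear_combination -h2' - g z * h1'

theorem wallDen_sub (z : ℂ) :
    wallDen α N g z - z * wallNum α N g z = caratheodoryDen α N g z := by
  obtain ⟨h1, h2⟩ := szegoPoly_eq_wall α N
  have h1' := congrArg (eval z) h1
  have h2' := congrArg (eval z) h2
  simp only [eval_sub, eval_mul, eval_X] at h1' h2'
  rw [caratheodoryDen, wallDen, wallNum]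
  linear_combination -h2' + g z * h1'

variable {g} in
theorem caratheodoryTransform_wallTransform_eventuallyEq (hg : AnalyticOnNhd ℂ g unitDisk) :
    caratheodoryTransform (wallTransform α N g) =ᶠ[codiscreteWithin unitDisk]
      fun z => caratheodoryNum α N g z / caratheodoryDen α N g z := by
  filter_upwards [eventually_wallDen_ne_zero α N hg] with z hz
  rw [caratheodoryTransform, wallTransform_eq, ← wallDen_add, ← wallDen_sub,
    ← mul_div_mul_right _ _ hz, add_mul, sub_mul, one_mul, mul_assoc z, div_mul_cancel₀ _ hz]

theorem caratheodoryDen_apply_zero : caratheodoryDen α N g 0 = 1 := by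
  simp [caratheodoryDen, eval_zero_szegoPolyStar]

variable {g} in
theorem analyticOnNhd_caratheodoryNum (hg : AnalyticOnNhd ℂ g unitDisk) :
    AnalyticOnNhd ℂ (caratheodoryNum α N g) unitDisk :=
  (analyticOnNhd_eval _ _).add ((analyticOnNhd_id.mul (analyticOnNhd_eval _ _)).mul hg)

variable {g} in
theorem analyticOnNhd_caratheodoryDen (hg : AnalyticOnNhd ℂ g unitDisk) :
    AnalyticOnNhd ℂ (caratheodoryDen α N g) unitDisk :=
  (analyticOnNhd_eval _ _).sub ((analyticOnNhd_id.mul (analyticOnNhd_eval _ _)).mul hg)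

variable {g} in
theorem analyticOrderAt_caratheodoryDen_ne_top (hg : AnalyticOnNhd ℂ g unitDisk) {z : ℂ}
    (hz : z ∈ unitDisk) : analyticOrderAt (caratheodoryDen α N g) z ≠ ⊤ := by
  intro h
  have h1 := (analyticOrderAt_eq_top.1 h).filter_mono (nhdsWithin_le_nhds (s := {z}ᶜ))
  have h2 := eventually_nhdsNE_of_codiscreteWithin (eventually_codiscreteWithin_ne_zero
    (analyticOnNhd_caratheodoryDen α N hg) (by simp [caratheodoryDen_apply_zero])) hz
  obtain ⟨w, hw1, hw2⟩ := (h1.and h2).exists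
  exact hw2 hw1

variable {α N} in
/-- The numerator and the denominator of the Carathéodory function have no common zeros. -/
theorem caratheodoryNum_ne_zero (hne : ∀ k < N, ‖α k‖ ≠ 1) {z : ℂ}
    (hz : caratheodoryDen α N g z = 0) : caratheodoryNum α N g z ≠ 0 := by
  intro hn
  have hz0 : z ≠ 0 := by
    rintro rfl
    simp [caratheodoryDen_apply_zero] at hz
  have hw := congrArg (eval z) (secondKind_wronskian α N)
  simp only [eval_add, eval_mul, eval_C, eval_pow, eval_X] at hw
  have hp := prod_one_sub_mul_conj_ne_zero α hne
  rw [caratheodoryDen] at hz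
  rw [caratheodoryNum] at hn
  -- Eliminating `g` from the two vanishing expressions leaves the Wronskian, which is nonzero
  -- because `z ≠ 0`.
  have h0 : z * (2 * (∏ k ∈ Finset.range N, (1 - α k * conj (α k))) * z ^ N) = 0 := by
    rw [← hw]
    linear_combination z * (szegoPoly α N).eval z * hn + z * (secondKindPoly α N).eval z * hz
  exact mul_ne_zero hz0 (mul_ne_zero (mul_ne_zero two_ne_zero hp) (pow_ne_zero N hz0)) h0

end WallTransform

/-! ### Poles of `F` as zeros of `R`, and their number. -/

section Poles

/-- The poles of a quotient of analytic functions without common zeros are the zeros of the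
denominator. -/
theorem poleOrder_of_eventuallyEq_div {F n d : ℂ → ℂ} {z : ℂ} (hn : AnalyticAt ℂ n z)
    (hd : AnalyticAt ℂ d z) (hF : F =ᶠ[𝓝[≠] z] fun w => n w / d w)
    (htop : analyticOrderAt d z ≠ ⊤) (hcop : d z = 0 → n z ≠ 0) :
    (meromorphicOrderAt F z < 0 ↔ d z = 0) ∧ (poleOrder F z : ℕ∞) = analyticOrderAt d z := by
  by_cases hdz : d z = 0
  · obtain ⟨k, hk⟩ := ENat.ne_top_iff_exists.1 htop
    have hk0 : k ≠ 0 := by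
      rintro rfl
      exact hd.analyticOrderAt_ne_zero.2 hdz (by rw [← hk]; rfl)
    have horder : meromorphicOrderAt F z = ((-(k : ℤ) : ℤ) : WithTop ℤ) := by
      rw [meromorphicOrderAt_congr hF]
      change meromorphicOrderAt (n / d) z = _
      rw [meromorphicOrderAt_div hn.meromorphicAt hd.meromorphicAt, hn.meromorphicOrderAt_eq,
        hd.meromorphicOrderAt_eq, hn.analyticOrderAt_eq_zero.2 (hcop hdz), ← hk]
      simp only [ENat.map_natCast, ENat.map_zero]
      norm_cast
      simp [Int.subNatNat_eq_coe]
    refine ⟨⟨fun _ => hdz, fun _ => ?_⟩, ?_⟩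
    · rw [horder]
      exact_mod_cast (by omega : (-(k : ℤ)) < 0)
    · rw [poleOrder, horder, ← hk, WithTop.untop₀_coe]
      simp
  · have hq : AnalyticAt ℂ (fun w => n w / d w) z := hn.div hd hdz
    have h0 : 0 ≤ meromorphicOrderAt F z := by
      rw [meromorphicOrderAt_congr hF]
      exact hq.meromorphicOrderAt_nonneg
    refine ⟨⟨fun h => absurd h (not_lt.2 h0), fun h => absurd h hdz⟩, ?_⟩
    rw [hd.analyticOrderAt_eq_zero.2 hdz, poleOrder]
    have h1 : 0 ≤ (meromorphicOrderAt F z).untop₀ := WithTop.untop₀_nonneg.2 h0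
    rw [Int.toNat_of_nonpos (by omega)]
    rfl

variable {α : ℕ → ℂ} {N : ℕ} {g : ℂ → ℂ}

/-- The zeros of `Φ_N^* - z Φ_N g` in the disk are at most as many as those of `Φ_N^*`. -/
theorem sum_le_numZerosInDisk (hne : ∀ k < N, ‖α k‖ ≠ 1) (hg : IsSchurFunction g)
    (Z : Finset ℂ) (e : ℂ → ℕ) (hZ : ∀ a ∈ Z, a ∈ unitDisk)
    (he : ∀ a ∈ Z, (e a : ℕ∞) ≤ analyticOrderAt (caratheodoryDen α N g) a) :
    ∑ a ∈ Z, e a ≤ numZerosInDisk (szegoPolyStar α N) := by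
  classical
  obtain ⟨S, hS, hfac⟩ :=
    exists_eq_rootPoly_mul Z e hZ (analyticOnNhd_caratheodoryDen α N hg.1) he
  obtain ⟨s, b, hcard, hs, hp, hb⟩ := exists_eq_rootPoly_filter_mul (szegoPolyStar_ne_zero α N)
    fun z hz => eval_szegoPolyStar_ne_zero_of_norm_eq_one α hne hz
  -- The comparison is made with `q = zΦ_N`, whose modulus on the circle is that of `Φ_N^*`.
  have key := card_le_card_of_sub_mul_eq_rootPoly_mul (q := X * szegoPoly α N) hp hs hb
    (fun z hz => by
      rw [eval_mul, eval_X, norm_mul, hz, one_mul, norm_eval_szegoPolyStar_of_norm_eq_one α hz])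
    hg (by simp [eval_zero_szegoPolyStar])
    (t := ∑ a ∈ Z, Multiset.replicate (e a) a)
    (fun a ha => by
      obtain ⟨c, hc, hac⟩ := Multiset.mem_sum.1 ha
      rw [Multiset.eq_of_mem_replicate hac]
      simpa using hZ c hc)
    hS (fun z hz => by rw [eval_mul, eval_X]; exact hfac z hz)
  rw [hcard, Multiset.card_sum] at key
  simpa using key

/-- A family of points with positive weights, finite subfamilies of which have bounded weight. -/
theorem finite_and_finsum_le_of_forall_finset {A : Set ℂ} {e : ℂ → ℕ} {n : ℕ}
    (hpos : ∀ a ∈ A, 0 < e a) (h : ∀ Z : Finset ℂ, ↑Z ⊆ A → ∑ a ∈ Z, e a ≤ n) :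
    A.Finite ∧ ∑ᶠ a ∈ A, e a ≤ n := by
  have hfin : A.Finite := by
    by_contra hinf
    obtain ⟨Z, hZ, hcard⟩ := Set.Infinite.exists_subset_card_eq hinf (n + 1)
    have h1 : Z.card ≤ ∑ a ∈ Z, e a := by
      rw [Finset.card_eq_sum_ones]
      exact Finset.sum_le_sum fun a ha => hpos a (hZ ha)
    have := h Z hZ
    omega
  refine ⟨hfin, ?_⟩
  rw [finsum_mem_eq_finite_toFinset_sum _ hfin]
  exact h _ (by simp)

end Poles

/-! ### The iterates of the generalized Schur algorithm. -/

section Iterates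

variable {α : ℕ → ℂ} {N : ℕ}

theorem exists_isGeneralizedSchurSequence {fN : ℂ → ℂ}
    (h : IsSchurFunctionOf (fun n => α (N + n)) fN) :
    ∃ s : ℕ → ℂ → ℂ, IsGeneralizedSchurSequence α s ∧ s 0 = wallTransform α N fN ∧ s N = fN ∧
      ∀ n, N ≤ n → IsSchurFunction (s n) := by
  obtain ⟨t, ht0, htS, ht⟩ := h
  have hfN : AnalyticOnNhd ℂ fN unitDisk := ht0 ▸ (htS 0).1
  -- Below `N` the iterate is rebuilt from `f_N` with the remaining `N - n` coefficients; from `N`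
  -- on the classical sequence takes over. At `n = N` both descriptions agree, the empty Wall
  -- transform being the identity.
  set s : ℕ → ℂ → ℂ := fun n =>
    if n < N then wallTransform (fun k => α (n + k)) (N - n) fN else t (n - N) with hs
  have hle : ∀ n ≤ N, s n = wallTransform (fun k => α (n + k)) (N - n) fN := fun n hn => by
    rcases hn.lt_or_eq with hlt | rfl
    · simp only [hs, if_pos hlt]
    · simp only [hs, lt_irrefl, if_false, Nat.sub_self, ht0, wallTransform_zero]
  have hge : ∀ n, N ≤ n → s n = t (n - N) := fun n hn => by
    simp only [hs, if_neg (not_lt.2 hn)]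
  refine ⟨s, fun n => ?_, ?_, ?_, fun n hn => ?_⟩
  · rcases lt_or_ge n N with hn | hn
    · obtain ⟨m, rfl⟩ : ∃ m, N = n + 1 + m := ⟨N - (n + 1), by omega⟩
      have h1 := wallTransform_succ_eventuallyEq (fun k => α (n + k)) m hfN
      rw [hle n hn.le, hle (n + 1) hn, show n + 1 + m - n = m + 1 by omega,
        show n + 1 + m - (n + 1) = m by omega]
      refine ⟨meromorphicOn_wallTransform _ _ hfN, analyticAt_wallTransform_zero _ _ hfN, ?_⟩
      simpa only [add_zero, add_assoc, add_comm 1] using h1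
    · rw [hge n hn, hge (n + 1) (by omega)]
      have hS := htS (n - N)
      refine ⟨fun z hz => (hS.1 z hz).meromorphicAt, hS.1 0 zero_mem_unitDisk, ?_⟩
      filter_upwards [self_mem_codiscreteWithin unitDisk] with z hz
      have h1 := ht (n - N) z hz
      simp only at h1
      rwa [show N + (n - N) = n by omega, show n - N + 1 = n + 1 - N by omega] at h1
  · rw [hle 0 (Nat.zero_le N)]
    simp
  · rw [hge N le_rfl, Nat.sub_self, ht0]
  · rw [hge n hn]
    exact htS _

end Iterates

end NonclassicalOPUC

theorem proposition2 (α : ℕ → ℂ) (N : ℕ)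
    (hne : ∀ n < N, ‖α n‖ ≠ 1) (hlt : ∀ n, N ≤ n → ‖α n‖ < 1) :
    -- the Schur function with coefficients `α_N, α_{N+1}, …` exists
    (∃ fN : ℂ → ℂ, IsSchurFunctionOf (fun n => α (N + n)) fN) ∧
    ∀ fN f F R : ℂ → ℂ,
      IsSchurFunctionOf (fun n => α (N + n)) fN →
      f = wallTransform α N fN →
      F = caratheodoryTransform f →
      R = (fun z => (szegoPolyStar α N).eval z - z * (szegoPoly α N).eval z * fN z) →
      -- `f_N` is a Schur function and the `N`-th iterate of the generalized Schur algorithm of `f`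
      IsSchurFunction fN ∧
      (∃ s : ℕ → ℂ → ℂ, IsGeneralizedSchurSequence α s ∧ s 0 = f ∧ s N = fN ∧
        ∀ n, N ≤ n → IsSchurFunction (s n)) ∧
      -- the representation of `F`, as an identity of meromorphic functions in the disk
      F =ᶠ[Filter.codiscreteWithin unitDisk] (fun z =>
        ((secondKindPolyStar α N).eval z + z * (secondKindPoly α N).eval z * fN z) / R z) ∧
      -- `F` is meromorphic in the disk
      MeromorphicOn F unitDisk ∧
      -- its poles in the disk are exactly the zeros of `R` there, with the same multiplicities
      polesInDisk F = {z | z ∈ unitDisk ∧ R z = 0} ∧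
      (∀ z ∈ unitDisk, (poleOrder F z : ℕ∞) = analyticOrderAt R z) ∧
      -- the number of poles is finite and at most the number of zeros of `Φ_N^*` in the disk
      (polesInDisk F).Finite ∧
      numPolesInDisk F ≤ numZerosInDisk (szegoPolyStar α N) := by
  refine ⟨exists_isSchurFunctionOf fun n => hlt _ (Nat.le_add_right N n), ?_⟩
  rintro fN f F R hfN rfl rfl rfl
  have hS : IsSchurFunction fN := by
    obtain ⟨t, rfl, ht, -⟩ := hfN
    exact ht 0
  set F := caratheodoryTransform (wallTransform α N fN) with hF
  have hEq := caratheodoryTransform_wallTransform_eventuallyEq α N hS.1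
  have hpole : ∀ z ∈ unitDisk, (meromorphicOrderAt F z < 0 ↔ caratheodoryDen α N fN z = 0) ∧
      (poleOrder F z : ℕ∞) = analyticOrderAt (caratheodoryDen α N fN) z := fun z hz =>
    poleOrder_of_eventuallyEq_div (analyticOnNhd_caratheodoryNum α N hS.1 z hz)
      (analyticOnNhd_caratheodoryDen α N hS.1 z hz)
      (eventually_nhdsNE_of_codiscreteWithin hEq hz)
      (analyticOrderAt_caratheodoryDen_ne_top α N hS.1 hz)
      (caratheodoryNum_ne_zero fN hne)
  have hpos : ∀ a ∈ polesInDisk F, 0 < poleOrder F a := fun a ha => by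
    have h1 := (analyticOnNhd_caratheodoryDen α N hS.1 a ha.1).analyticOrderAt_ne_zero.2
      ((hpole a ha.1).1.1 ha.2)
    rw [← (hpole a ha.1).2] at h1
    exact Nat.pos_of_ne_zero (by exact_mod_cast h1)
  -- Finiteness is not known beforehand: the zero count bounds every finite set of poles uniformly,
  -- which yields both finiteness and the bound.
  obtain ⟨hfin, hcard⟩ := finite_and_finsum_le_of_forall_finset hpos fun Z hZ =>
    sum_le_numZerosInDisk hne hS Z (poleOrder F) (fun a ha => (hZ ha).1)
      fun a ha => (hpole a (hZ ha).1).2.le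
  refine ⟨hS, exists_isGeneralizedSchurSequence hfN, hEq, fun z hz => ?_, ?_,
    fun z hz => (hpole z hz).2, hfin, hcard⟩
  · have hw := meromorphicOn_wallTransform α N hS.1 z hz
    have hid : MeromorphicAt (fun w : ℂ => w) z := analyticAt_id.meromorphicAt
    exact ((MeromorphicAt.const 1 z).add (hid.mul hw)).div
      ((MeromorphicAt.const 1 z).sub (hid.mul hw))
  · ext z
    exact and_congr_right fun hz => (hpole z hz).1
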